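/- Let $y = Ax + v$ with unknowns $x \in \mathbb{R}^p$, noise $v \in \mathbb{R}^n$ and regressors $A \in \mathbb{R}^{n\times p}$, where $x$ and $v$ are zero-mean, uncorrelated random vectors with finite second moments and covariance matrices $K_x$, $K_v$, and the rows of $A$ are i.i.d. $\mathcal{N}(0, I_p)$. Let $S \subseteq \{1,\dots,p\}$ be nonempty, $p_S = |S|$, let $C$ be the complement of $S$, $p_C = p - p_S$, and let $x_S, x_C$ be the corresponding subvectors of $x$ and $A_S$ the submatrix of the columns of $A$ with indices in $S$. Let $W_S = A_S^{\mathrm T}(A_S A_S^{\mathrm T})^+$, where $^+$ is the Moore-Penrose pseudoinverse; this is the LMMSE estimator for the assumed model $y = A_S x_S$ with $\mathrm{Cov}(x_S) = I$ and no noise. For fixed $A$ put $J_S(A) = \mathbb{E}_{x,v}\big[\|x_S - W_S y\|^2\big]$, and let $\varepsilon_S = \mathbb{E}_A[J_S(A)]$ and $\varepsilon = \varepsilon_S + \operatorname{tr}(K_{x_C})$. Let $\sigma_x, \sigma_v > 0$ and assume that $\operatorname{tr}(K_{x_S}) = \sigma_x^2 p_S$, $\operatorname{tr}(K_{x_C})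 = \sigma_x^2 p_C$, $\operatorname{tr}(K_v) = n\sigma_v^2$, and $n > p + 1$. Then all these expectations are finite, and $\varepsilon$ depends on the system and on $S$ only through $p_S$, $p$, $n$, $\sigma_x$, $\sigma_v$: it is $\varepsilon = \varepsilon(p_S, n)$ with \[ \varepsilon(t, n) = \sigma_x^2\,(t - \min\{t, n\}) + \frac{t}{n - t - 1}\big(\sigma_x^2 (p - t) + \sigma_v^2\big) + \sigma_x^2 (p - t), \qquad 0 < t \le p. \] If $n > p + \sigma_v^2/\sigma_x^2 + 1$, then $\varepsilon(t,n)$ is strictly decreasing in the real variable $t \in (0, p]$, and hence the expected MSE is strictly decreasing in $p_S$. If $n < p + \sigma_v^2/\sigma_x^2 + 1$, then $\varepsilon(t,n)$ is strictly increasing in $t \in (0,p]$, and hence the expected MSE is strictly increasing in $p_S$. -/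

import Mathlib

open MeasureTheory ProbabilityTheory Matrix

universe u₁ u₂

noncomputable section

namespace PartialLMMSE

/-! ### The Moore-Penrose pseudoinverse of a real matrix -/

section Pseudoinverse

variable {m k : Type*} [Fintype m] [Fintype k]

/-- `B` satisfies the four Penrose equations for the real matrix `A`. -/
structure IsMoorePenrose (A : Matrix m k ℝ) (B : Matrix k m ℝ) : Prop where
  mul_mul_left : A * B * A = A
  mul_mul_right : B * A * B = B
  symm_left : (A * B)ᵀ = A * B
  symm_right : (B * A)ᵀ = B * A

theorem IsMoorePenrose.unique {A : Matrix m k ℝ} {B C : Matrix k m ℝ}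
    (hB : IsMoorePenrose A B) (hC : IsMoorePenrose A C) : B = C := by
  have h1 : A * B = A * C := by
    calc A * B = (A * B)ᵀ := hB.symm_left.symm
      _ = ((A * C * A) * B)ᵀ := by rw [hC.mul_mul_left]
      _ = (A * B)ᵀ * (A * C)ᵀ := by rw [← transpose_mul]; simp only [Matrix.mul_assoc]
      _ = A * B * (A * C) := by rw [hB.symm_left, hC.symm_left]
      _ = A * B * A * C := by simp only [Matrix.mul_assoc]
      _ = A * C := by rw [hB.mul_mul_left]
  have h2 : B * A = C * A := by
    calc B * A = (B * A)ᵀ := hB.symm_right.symm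
      _ = (B * (A * C * A))ᵀ := by rw [hC.mul_mul_left]
      _ = (C * A)ᵀ * (B * A)ᵀ := by rw [← transpose_mul]; simp only [Matrix.mul_assoc]
      _ = C * A * (B * A) := by rw [hB.symm_right, hC.symm_right]
      _ = C * (A * B * A) := by simp only [Matrix.mul_assoc]
      _ = C * A := by rw [hB.mul_mul_left]
  calc B = B * A * B := hB.mul_mul_right.symm
    _ = C * A * B := by rw [h2]
    _ = C * (A * B) := Matrix.mul_assoc _ _ _
    _ = C * (A * C) := by rw [h1]
    _ = C * A * C := (Matrix.mul_assoc _ _ _).symm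
    _ = C := hC.mul_mul_right

theorem IsMoorePenrose.exists_of_isHermitian [DecidableEq k] {H : Matrix k k ℝ}
    (hH : H.IsHermitian) : ∃ B, Bᵀ = B ∧ IsMoorePenrose H B := by
  set U : Matrix k k ℝ := (hH.eigenvectorUnitary).1
  have hU : Uᵀ * U = 1 := by
    have := (Matrix.mem_unitaryGroup_iff'.1 hH.eigenvectorUnitary.2)
    simpa [star_eq_conjTranspose, conjTranspose_eq_transpose_of_trivial] using this
  set d : k → ℝ := hH.eigenvalues
  have hspec : H = U * diagonal d * Uᵀ := by
    have := hH.spectral_theorem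
    simpa [Unitary.conjStarAlgAut_apply, star_eq_conjTranspose,
      conjTranspose_eq_transpose_of_trivial, Function.comp_def] using this
  have key : ∀ a b : k → ℝ, (U * diagonal a * Uᵀ) * (U * diagonal b * Uᵀ)
      = U * diagonal (fun i => a i * b i) * Uᵀ := by
    intro a b
    calc (U * diagonal a * Uᵀ) * (U * diagonal b * Uᵀ)
        = U * diagonal a * (Uᵀ * U) * diagonal b * Uᵀ := by simp only [Matrix.mul_assoc]
      _ = _ := by rw [hU, Matrix.mul_one, Matrix.mul_assoc U, diagonal_mul_diagonal]
  have hsymm : ∀ a : k → ℝ, (U * diagonal a * Uᵀ)ᵀ = U * diagonal a * Uᵀ := by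
    intro a
    simp [transpose_mul, Matrix.mul_assoc]
  refine ⟨U * diagonal (fun i => (d i)⁻¹) * Uᵀ, hsymm _, ?_⟩
  rw [hspec]
  constructor
  · rw [key, key]
    congr 3; ext i
    exact mul_inv_mul_cancel (d i)
  · rw [key, key]
    congr 3; ext i
    by_cases h : d i = 0 <;> simp [h]
  · rw [key, hsymm]
  · rw [key, hsymm]

theorem IsMoorePenrose.exists (A : Matrix m k ℝ) : ∃ B, IsMoorePenrose A B := by
  classical
  have hH : (Aᵀ * A).IsHermitian := by
    simp [Matrix.IsHermitian, conjTranspose_eq_transpose_of_trivial, transpose_mul]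
  obtain ⟨P, hPs, hP⟩ := IsMoorePenrose.exists_of_isHermitian hH
  have hz : A * (P * (Aᵀ * A)) - A = 0 := by
    have h0 : Aᵀ * (A * (P * (Aᵀ * A)) - A) = 0 := by
      have := hP.mul_mul_left
      rw [Matrix.mul_sub, sub_eq_zero, ← this]
      simp only [Matrix.mul_assoc] at this ⊢
      simp only [this]
    rw [← conjTranspose_mul_self_eq_zero, conjTranspose_eq_transpose_of_trivial]
    have e : A * (P * (Aᵀ * A)) - A = A * (P * (Aᵀ * A) - 1) := by
      rw [Matrix.mul_sub, Matrix.mul_one]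
    calc (A * (P * (Aᵀ * A)) - A)ᵀ * (A * (P * (Aᵀ * A)) - A)
        = (P * (Aᵀ * A) - 1)ᵀ * (Aᵀ * (A * (P * (Aᵀ * A)) - A)) := by
          conv_lhs => rw [e, transpose_mul, ← e]
          rw [Matrix.mul_assoc]
      _ = 0 := by rw [h0, Matrix.mul_zero]
  refine ⟨P * Aᵀ, ?_, ?_, ?_, ?_⟩
  · have := sub_eq_zero.1 hz
    simpa only [Matrix.mul_assoc] using this
  · have := hP.mul_mul_right
    calc P * Aᵀ * A * (P * Aᵀ) = (P * (Aᵀ * A) * P) * Aᵀ := by simp only [Matrix.mul_assoc]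
      _ = P * Aᵀ := by rw [this]
  · simp [transpose_mul, hPs, Matrix.mul_assoc]
  · have := hP.symm_right
    simpa only [Matrix.mul_assoc] using this

/-- The Moore-Penrose pseudoinverse `A⁺` of a real matrix: the unique solution of the four
Penrose equations. -/
def pinv (A : Matrix m k ℝ) : Matrix k m ℝ := (IsMoorePenrose.exists A).choose

theorem pinv_spec (A : Matrix m k ℝ) : IsMoorePenrose A (pinv A) :=
  (IsMoorePenrose.exists A).choose_spec

end Pseudoinverse

/-! ### The LMMSE estimator of an assumed linear model -/

/-- The LMMSE estimator `K̂ₓ Aᵀ (A K̂ₓ Aᵀ + K̂_z)⁺` for the model `y = A x + z`, with zero-mean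
uncorrelated `x`, `z` of covariances `K̂ₓ`, `K̂_z`. -/
def lmmse {m k : Type*} [Fintype m] [Fintype k] (Kx : Matrix k k ℝ) (Kz : Matrix m m ℝ)
    (A : Matrix m k ℝ) : Matrix k m ℝ :=
  Kx * Aᵀ * pinv (A * Kx * Aᵀ + Kz)

/-- The cross-covariance matrix of two random vectors. -/
def crossCov {Ω : Type*} [MeasurableSpace Ω] (P : Measure Ω) {k l : Type*}
    (z : Ω → k → ℝ) (w : Ω → l → ℝ) : Matrix k l ℝ :=
  Matrix.of fun i j => covariance (fun ω => z ω i) (fun ω => w ω j) P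

/-- The underlying system `y = A x + v` with `p` unknowns and `n` observations.

`x` and `v` are zero-mean uncorrelated random vectors with finite second moments, and `A` is a
random matrix whose rows are independent with law `N(0, I_p)`. The expectation over `A` is always
taken separately, after the expectation over `x` and `v` for a fixed matrix of regressors, so `A`
lives on a probability space of its own. -/
structure LinearSystem (p n : ℕ) where
  /-- The probability space of the unknowns and the noise. -/
  Ω : Type u₁
  [mΩ : MeasurableSpace Ω]
  P : Measure Ω
  [prob_P : IsProbabilityMeasure P]
  /-- The unknowns. -/
  x : Ω → Fin p → ℝ
  /-- The noise. -/
  v : Ω → Fin n → ℝ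
  memLp_x : ∀ i, MemLp (fun ω => x ω i) 2 P
  memLp_v : ∀ j, MemLp (fun ω => v ω j) 2 P
  mean_x : ∀ i, ∫ ω, x ω i ∂P = 0
  mean_v : ∀ j, ∫ ω, v ω j ∂P = 0
  uncorrelated : crossCov P x v = 0
  /-- The probability space of the regressors. -/
  Ω' : Type u₂
  [mΩ' : MeasurableSpace Ω']
  Q : Measure Ω'
  [prob_Q : IsProbabilityMeasure Q]
  /-- The matrix of regressors. -/
  A : Ω' → Matrix (Fin n) (Fin p) ℝ
  indep_rows : iIndepFun (fun (i : Fin n) (ω : Ω') => WithLp.toLp 2 (A ω i)) Q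
  law_rows : ∀ i, HasLaw (fun ω => WithLp.toLp 2 (A ω i))
    (multivariateGaussian (0 : EuclideanSpace ℝ (Fin p)) 1) Q

attribute [instance] LinearSystem.mΩ LinearSystem.prob_P LinearSystem.mΩ' LinearSystem.prob_Q

namespace LinearSystem

variable {p n : ℕ} (M : LinearSystem.{u₁, u₂} p n) (S : Finset (Fin p))

/-- The observations for a given matrix of regressors. -/
def y (A : Matrix (Fin n) (Fin p) ℝ) (ω : M.Ω) : Fin n → ℝ := A *ᵥ M.x ω + M.v ω

/-- The subvector of the unknowns with indices in `S`. -/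
def xSub (ω : M.Ω) : S → ℝ := fun i => M.x ω i

/-- The covariance matrix of the subvector of the unknowns with indices in `S`. -/
def covXSub : Matrix S S ℝ := crossCov M.P (M.xSub S) (M.xSub S)

/-- The covariance matrix of the noise. -/
def covV : Matrix (Fin n) (Fin n) ℝ := crossCov M.P M.v M.v

/-- The squared error `‖x_S - W y‖²` of the estimate `W y`. -/
def sqError (A : Matrix (Fin n) (Fin p) ℝ) (W : Matrix S (Fin n) ℝ) (ω : M.Ω) : ℝ :=
  ‖WithLp.toLp 2 (M.xSub S ω - W *ᵥ M.y A ω)‖ ^ 2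

/-- The mean squared error `J_S(W)`, for a given matrix of regressors. -/
def mseS (A : Matrix (Fin n) (Fin p) ℝ) (W : Matrix S (Fin n) ℝ) : ℝ :=
  ∫ ω, M.sqError S A W ω ∂M.P

end LinearSystem

/-- The partial LMMSE estimator of `x_S`, from the assumed model `y = A_S x_S + z` in which
`x_S` has covariance `I` and `z` has covariance `0`. -/
def partialLMMSE {p n : ℕ} (S : Finset (Fin p)) (A : Matrix (Fin n) (Fin p) ℝ) :
    Matrix S (Fin n) ℝ :=
  lmmse 1 0 (A.submatrix id (fun i : S => (i : Fin p)))

namespace LinearSystem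

variable {p n : ℕ} (M : LinearSystem.{u₁, u₂} p n) (S : Finset (Fin p))

/-- The expected MSE `ε_S` of the partial LMMSE estimator of `x_S`, over the regressors. -/
def expectedMSES : ℝ := ∫ ω', M.mseS S (M.A ω') (partialLMMSE S (M.A ω')) ∂M.Q

/-- The total expected MSE `ε = ε_S + tr K_{x_C}`. -/
def expectedMSE : ℝ := M.expectedMSES S + (M.covXSub Sᶜ).trace

/-- The powers of `x_S` and `x_C` are proportional to their dimensions, with the factor `σ_x²`,
and the noise power per sample is `σ_v²`. At least one unknown is estimated. -/
structure HasPowers (σx σv : ℝ) : Prop where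
  nonempty : S.Nonempty
  trace_S : (M.covXSub S).trace = σx ^ 2 * S.card
  trace_C : (M.covXSub Sᶜ).trace = σx ^ 2 * Sᶜ.card
  trace_v : M.covV.trace = n * σv ^ 2

end LinearSystem

/-- The total expected MSE as a function of a real variable `t` in place of `p_S`, for `t < n - 1`:
`σ_x² (t - min t n) + γ (σ_x² (p - t) + σ_v²) + σ_x² (p - t)` with `γ = t / (n - t - 1)`. -/
def mseCurve (p n : ℕ) (σx σv t : ℝ) : ℝ :=
  σx ^ 2 * (t - min t n) + t / (n - t - 1) * (σx ^ 2 * (p - t) + σv ^ 2) + σx ^ 2 * (p - t)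

end PartialLMMSE

end

/-! Since n > p + 1 ≥ p_S + 1, the Gaussian columns of A_S are almost surely linearly independent.
With G = A_Sᵀ A_S the pseudoinverse of A_S A_Sᵀ is then A_S G⁻² A_Sᵀ, so W_S = G⁻¹ A_Sᵀ is the
least-squares estimator and W_S A_S = 1 (`lmmse_one_zero`, `partialLMMSE_mul_apply`). The unknowns
x_S cancel from the error, which is -(W_S A_C x_C + W_S v). As x and v are uncorrelated, J_S is the
sum over the rows w_j of W_S of w_jᵀ (A_C K_{x_C} A_Cᵀ + K_v) w_j (`mseS_eq_of_mul_eq`).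

The rows w_j form the dual family of the columns of A_S. Hence w_j is independent of A_C, and its
law is invariant under isometries, so E[w_j w_jᵀ] = (E‖w_j‖² / n) I (`integral_dualFamily_mul`).
Moreover ‖w_j‖ is the reciprocal of the distance from column j to the span V of the other columns of
A_S (`norm_sq_dualFamily`). Given those columns, the squared distance is chi-squared with n - p_S +
1 degrees of freedom, whose inverse moment is 1 / (n - p_S - 1) (`lintegral_norm_sq_dualFamily`).
Summing over j gives ε_S = p_S / (n - p_S - 1) · (tr K_{x_C} + tr K_v / n).

For monotonicity, the curve is a constant plus a multiple of 1 / (n - t - 1), and the sign of the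
multiple is that of p + σ_v²/σ_x² + 1 - n (`mseCurve_eq`). -/

/-! ### Inverse moments of chi-squared variables and Gaussian projections -/

section InverseMoment

open Set Filter Topology

theorem integral_exp_neg_mul_sq_gaussianReal {t : ℝ} (ht : 0 ≤ t) :
    ∫ x, Real.exp (-t * x ^ 2) ∂(gaussianReal 0 1) = (1 + 2 * t) ^ (-(1 / 2) : ℝ) := by
  rw [integral_gaussianReal_eq_integral_smul (by norm_num)]
  have h : ∀ x : ℝ, gaussianPDFReal 0 1 x • Real.exp (-t * x ^ 2)
      = (√(2 * Real.pi))⁻¹ * Real.exp (-(t + 1 / 2) * x ^ 2) := by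
    intro x
    rw [gaussianPDFReal, smul_eq_mul, mul_assoc, ← Real.exp_add]
    simp only [NNReal.coe_one, mul_one, sub_zero]
    ring_nf
  simp_rw [h]
  rw [integral_const_mul, integral_gaussian, Real.rpow_neg (by linarith), ← Real.sqrt_eq_rpow,
    ← Real.sqrt_inv, ← Real.sqrt_inv, ← Real.sqrt_mul (by positivity)]
  congr 1
  have := Real.pi_pos
  field_simp
  ring

/-- Turns an inverse moment into an integral of Laplace transforms. In `ENNReal` it includes r = 0,
where both sides are infinite. -/
theorem lintegral_exp_neg_mul_Ioi (r : ℝ) (hr : 0 ≤ r) :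
    ∫⁻ t in Ioi (0 : ℝ), ENNReal.ofReal (Real.exp (-t * r)) = (ENNReal.ofReal r)⁻¹ := by
  rcases hr.eq_or_lt with rfl | hr
  · simp
  · rw [← ofReal_integral_eq_lintegral_ofReal]
    · have := integral_exp_mul_Ioi (a := -r) (by linarith) 0
      simp_rw [show ∀ t : ℝ, -t * r = -r * t from fun t => by ring]
      rw [this, ← ENNReal.ofReal_inv_of_pos hr]
      congr 1
      simp
    · have := integrableOn_exp_mul_Ioi (a := -r) (by linarith) 0
      simp_rw [show ∀ t : ℝ, -t * r = -r * t from fun t => by ring]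
      exact this
    · exact ae_of_all _ fun t => (Real.exp_pos _).le

theorem lintegral_one_add_two_mul_rpow_Ioi {a : ℝ} (ha : 1 < a) :
    ∫⁻ t in Ioi (0 : ℝ), ENNReal.ofReal ((1 + 2 * t) ^ (-a))
      = ENNReal.ofReal (1 / (2 * (a - 1))) := by
  have hderiv : ∀ t ∈ Ici (0 : ℝ), HasDerivAt
      (fun t : ℝ => -(1 / (2 * (a - 1))) * (1 + 2 * t) ^ (1 - a)) ((1 + 2 * t) ^ (-a)) t := by
    intro t ht
    have ht : 0 ≤ t := ht
    have h1 : HasDerivAt (fun t : ℝ => 1 + 2 * t) 2 t := by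
      simpa using ((hasDerivAt_id t).const_mul 2).const_add 1
    have h2 := (h1.rpow_const (p := 1 - a) (Or.inl (by positivity))).const_mul
      (-(1 / (2 * (a - 1))))
    refine h2.congr_deriv ?_
    have : a - 1 ≠ 0 := by linarith
    rw [show 1 - a - 1 = -a by ring]
    field_simp
    ring
  have hlim : Tendsto (fun t : ℝ => -(1 / (2 * (a - 1))) * (1 + 2 * t) ^ (1 - a)) atTop (𝓝 0) := by
    have h1 : Tendsto (fun t : ℝ => 1 + 2 * t) atTop atTop :=
      tendsto_atTop_add_const_left _ _ (tendsto_id.const_mul_atTop (by norm_num))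
    have h2 := (tendsto_rpow_neg_atTop (y := a - 1) (by linarith)).comp h1
    simpa [Function.comp_def] using h2.const_mul (-(1 / (2 * (a - 1))))
  have hpos : ∀ t ∈ Ioi (0 : ℝ), 0 ≤ (1 + 2 * t) ^ (-a) := fun t ht => by
    have : 0 < t := ht
    positivity
  rw [← ofReal_integral_eq_lintegral_ofReal]
  · rw [integral_Ioi_of_hasDerivAt_of_nonneg' hderiv hpos hlim]
    simp
  · exact integrableOn_Ioi_deriv_of_nonneg' hderiv hpos hlim
  · exact (ae_restrict_iff' measurableSet_Ioi).2 (ae_of_all _ hpos)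

variable {E : Type*} [NormedAddCommGroup E] [InnerProductSpace ℝ E] [FiniteDimensional ℝ E]
  [MeasurableSpace E] [BorelSpace E]

theorem lintegral_exp_neg_mul_norm_sq_stdGaussian {t : ℝ} (ht : 0 ≤ t) :
    ∫⁻ x, ENNReal.ofReal (Real.exp (-t * ‖x‖ ^ 2)) ∂(stdGaussian E)
      = ENNReal.ofReal ((1 + 2 * t) ^ (-(Module.finrank ℝ E / 2) : ℝ)) := by
  rw [← ofReal_integral_eq_lintegral_ofReal]
  rotate_left
  · refine Integrable.of_bound (C := 1) (by fun_prop) (ae_of_all _ fun x => ?_)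
    rw [Real.norm_eq_abs, Real.abs_exp, Real.exp_le_one_iff]
    nlinarith [sq_nonneg ‖x‖, mul_nonneg ht (sq_nonneg ‖x‖)]
  · exact ae_of_all _ fun t => (Real.exp_pos _).le
  congr 1
  have hn : ∀ x : Fin (Module.finrank ℝ E) → ℝ,
      Real.exp (-t * ‖∑ i, x i • stdOrthonormalBasis ℝ E i‖ ^ 2)
        = ∏ i, Real.exp (-t * x i ^ 2) := by
    intro x
    rw [← Real.exp_sum, ← Finset.mul_sum]
    congr 2
    rw [← real_inner_self_eq_norm_sq, (stdOrthonormalBasis ℝ E).orthonormal.inner_sum]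
    simp [sq]
  rw [stdGaussian, integral_map (Measurable.aemeasurable (by fun_prop))
    (Measurable.aestronglyMeasurable (by fun_prop))]
  simp_rw [hn]
  rw [integral_fintype_prod_eq_prod (f := fun _ x => Real.exp (-t * x ^ 2))]
  simp_rw [integral_exp_neg_mul_sq_gaussianReal ht]
  rw [Finset.prod_const, Finset.card_univ, Fintype.card_fin, ← Real.rpow_mul_natCast (by linarith)]
  congr 1
  ring

/-- The inverse moment of a chi-squared variable with `d ≥ 3` degrees of freedom is
`1 / (d - 2)`. -/
theorem lintegral_inv_norm_sq_stdGaussian (hE : 3 ≤ Module.finrank ℝ E) :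
    ∫⁻ x, (ENNReal.ofReal (‖x‖ ^ 2))⁻¹ ∂(stdGaussian E)
      = ENNReal.ofReal (1 / (Module.finrank ℝ E - 2)) := by
  -- By Tonelli the inverse moment is the integral over t > 0 of the Laplace transform (1 +
  -- 2t)^(-d/2) of ‖x‖².
  simp_rw [← fun x : E => lintegral_exp_neg_mul_Ioi (‖x‖ ^ 2) (sq_nonneg _)]
  rw [lintegral_lintegral_swap (Measurable.aemeasurable (by fun_prop))]
  have h : ∀ t ∈ Ioi (0 : ℝ), ∫⁻ x, ENNReal.ofReal (Real.exp (-t * ‖x‖ ^ 2)) ∂(stdGaussian E)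
      = ENNReal.ofReal ((1 + 2 * t) ^ (-(Module.finrank ℝ E / 2) : ℝ)) :=
    fun t ht => lintegral_exp_neg_mul_norm_sq_stdGaussian (le_of_lt ht)
  rw [setLIntegral_congr_fun measurableSet_Ioi h]
  have h3 : (3 : ℝ) ≤ Module.finrank ℝ E := by exact_mod_cast hE
  rw [lintegral_one_add_two_mul_rpow_Ioi (by linarith)]
  congr 2
  ring

/-- For t in U, pairing the projection of x with t equals pairing x with t, so the characteristic
functions agree. -/
theorem stdGaussian_map_orthogonalProjectionOnto (U : Submodule ℝ E) :
    (stdGaussian E).map U.orthogonalProjectionOnto = stdGaussian U := by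
  apply Measure.ext_of_charFun
  ext t
  rw [charFun_stdGaussian, charFun_apply, integral_map (by fun_prop) (by fun_prop)]
  have : ∀ x : E, inner ℝ (U.orthogonalProjectionOnto x) t = inner ℝ x (t : E) := fun x => by
    rw [Submodule.coe_inner, Submodule.coe_orthogonalProjectionOnto_apply,
      Submodule.inner_starProjection_left_eq_right]
    simp
  simp_rw [this]
  rw [← charFun_apply, charFun_stdGaussian]
  simp

theorem lintegral_inv_norm_sq_orthogonalProjection (V : Submodule ℝ E)
    (hV : Module.finrank ℝ V + 3 ≤ Module.finrank ℝ E) :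
    ∫⁻ x, (ENNReal.ofReal (‖Vᗮ.starProjection x‖ ^ 2))⁻¹ ∂(stdGaussian E)
      = ENNReal.ofReal (1 / (Module.finrank ℝ E - Module.finrank ℝ V - 2)) := by
  have hd := V.finrank_add_finrank_orthogonal
  have := lintegral_inv_norm_sq_stdGaussian (E := Vᗮ) (by omega)
  rw [← stdGaussian_map_orthogonalProjectionOnto, lintegral_map (by fun_prop) (by fun_prop)] at this
  simp only [Submodule.starProjection_apply, Submodule.coe_norm] at this ⊢
  rw [this, ← hd]
  push_cast
  congr 3
  ring

/-- A finite inverse moment forces the projection to Vᗮ to be nonzero almost everywhere; codimension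
3 is what makes that moment finite. -/
theorem ae_notMem_submodule_stdGaussian (V : Submodule ℝ E)
    (hV : Module.finrank ℝ V + 3 ≤ Module.finrank ℝ E) :
    ∀ᵐ x ∂(stdGaussian E), x ∉ V := by
  have h := lintegral_inv_norm_sq_orthogonalProjection V hV
  have h2 := ae_lt_top (μ := stdGaussian E)
    (f := fun x => (ENNReal.ofReal (‖Vᗮ.starProjection x‖ ^ 2))⁻¹) (by fun_prop)
    (by rw [h]; exact ENNReal.ofReal_ne_top)
  filter_upwards [h2] with x hx hxV
  have h0 : Vᗮ.starProjection x = 0 := by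
    rw [Submodule.starProjection_apply_eq_zero_iff, Submodule.orthogonal_orthogonal]
    exact hxV
  simp [h0] at hx

end InverseMoment

/-! ### Resampling one coordinate of a product measure -/

section PiUpdate

variable {ι : Type*} [Fintype ι] [DecidableEq ι] {X : ι → Type*} [∀ i, MeasurableSpace (X i)]
  {μ : ∀ i, Measure (X i)} [∀ i, IsProbabilityMeasure (μ i)]

/-- Replacing coordinate j by a fresh copy preserves the law. This serves as conditioning on the
other coordinates without splitting the product. -/
theorem lintegral_pi_eq_lintegral_update (j : ι) {f : (∀ i, X i) → ENNReal} (hf : Measurable f) :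
    ∫⁻ x, f x ∂(Measure.pi μ)
      = ∫⁻ x, ∫⁻ y, f (Function.update x j y) ∂(μ j) ∂(Measure.pi μ) := by
  have hne : Nonempty (∀ i, X i) := nonempty_of_isProbabilityMeasure (Measure.pi μ)
  obtain ⟨x₀⟩ := hne
  have hg : Measurable fun x : ∀ i, X i => ∫⁻ y, f (Function.update x j y) ∂(μ j) := by
    rw [← lmarginal_singleton]
    exact hf.lmarginal μ
  rw [lintegral_eq_lmarginal_univ x₀, lintegral_eq_lmarginal_univ x₀,
    lmarginal_erase' f hf (Finset.mem_univ j), lmarginal_erase' _ hg (Finset.mem_univ j)]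
  simp

theorem ae_pi_of_ae_update (j : ι) {p : (∀ i, X i) → Prop} (hp : MeasurableSet {x | p x})
    (h : ∀ᵐ x ∂(Measure.pi μ), ∀ᵐ y ∂(μ j), p (Function.update x j y)) :
    ∀ᵐ x ∂(Measure.pi μ), p x := by
  rw [ae_iff, ← lintegral_indicator_one (by exact hp.compl),
    lintegral_pi_eq_lintegral_update j (measurable_one.indicator (by exact hp.compl)),
    lintegral_eq_zero_iff']
  · filter_upwards [h] with x hx
    rw [Pi.zero_apply, lintegral_eq_zero_iff']
    · filter_upwards [hx] with y hy
      simpa using hy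
    · exact ((measurable_one.indicator (by exact hp.compl)).comp
        (measurable_update x)).aemeasurable
  · have h1 : Measurable ({x | p x}ᶜ.indicator (1 : (∀ i, X i) → ENNReal)) :=
      measurable_one.indicator hp.compl
    have h2 := h1.lmarginal μ (s := {j})
    rw [lmarginal_singleton] at h2
    exact h2.aemeasurable

end PiUpdate

/-! ### The dual family of linearly independent vectors -/

section DualFamily

variable {ι : Type*} [Fintype ι] [DecidableEq ι] {E : Type*} [NormedAddCommGroup E]
  [InnerProductSpace ℝ E]

/-- The family dual to `c` in the span of `c`, when `c` is linearly independent. -/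
noncomputable def dualFamily (c : ι → E) (j : ι) : E := ∑ k, (gram ℝ c)⁻¹ j k • c k

theorem inner_dualFamily {c : ι → E} (hc : LinearIndependent ℝ c) (j k : ι) :
    inner ℝ (dualFamily c j) (c k) = if j = k then 1 else 0 := by
  have hu : IsUnit (gram ℝ c).det := (det_gram_ne_zero_iff_linearIndependent.2 hc).isUnit
  rw [dualFamily, sum_inner, ← Matrix.one_apply, ← Matrix.nonsing_inv_mul _ hu, Matrix.mul_apply]
  simp [inner_smul_left, gram_apply]

theorem dualFamily_linearIsometryEquiv_comp (c : ι → E) (j : ι) (L : E ≃ₗᵢ[ℝ] E) :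
    dualFamily (fun k => L (c k)) j = L (dualFamily c j) := by
  have : gram ℝ (fun k => L (c k)) = gram ℝ c := by
    ext a b
    simp [gram_apply]
  simp [dualFamily, this]

/-- The dual vector w is orthogonal to V, so projecting its expansion onto Vᗮ leaves only the j-th
term: w = m P c_j. Pairing with c_j gives m ‖P c_j‖² = 1, hence ‖w‖² = m. -/
theorem norm_sq_dualFamily [FiniteDimensional ℝ E] {c : ι → E} (hc : LinearIndependent ℝ c)
    (j : ι) : ‖dualFamily c j‖ ^ 2
      = (‖(Submodule.span ℝ (c '' {j}ᶜ))ᗮ.starProjection (c j)‖ ^ 2)⁻¹ := by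
  set V := Submodule.span ℝ (c '' {j}ᶜ)
  set w := dualFamily c j with hw
  set m := (gram ℝ c)⁻¹ j j
  have hV : ∀ k ≠ j, c k ∈ V := fun k hk => Submodule.subset_span ⟨k, hk, rfl⟩
  have hwV : w ∈ Vᗮ := by
    rw [Submodule.mem_orthogonal']
    intro u hu
    induction hu using Submodule.span_induction with
    | mem x hx =>
      obtain ⟨k, hk, rfl⟩ := hx
      rw [hw, inner_dualFamily hc, if_neg (Ne.symm hk)]
    | zero => simp
    | add x y _ _ hx hy => rw [inner_add_right, hx, hy, add_zero]
    | smul a x _ hx => rw [inner_smul_right, hx, mul_zero]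
  have h1 : w = m • Vᗮ.starProjection (c j) := by
    conv_lhs => rw [← Submodule.starProjection_eq_self_iff.2 hwV]
    rw [hw, dualFamily, map_sum, Finset.sum_eq_single j]
    · simp [m]
    · intro k _ hk
      rw [map_smul, Submodule.starProjection_apply_eq_zero_iff _ |>.2, smul_zero]
      rw [Submodule.orthogonal_orthogonal]
      exact hV k hk
    · simp
  have h2 : inner ℝ w (Vᗮ.starProjection (c j)) = 1 := by
    rw [← Submodule.inner_starProjection_left_eq_right,
      Submodule.starProjection_eq_self_iff.2 hwV, hw, inner_dualFamily hc, if_pos rfl]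
  rw [h1, inner_smul_left, real_inner_self_eq_norm_sq] at h2
  rw [h1, norm_smul, mul_pow, Real.norm_eq_abs, sq_abs]
  have hne : ‖Vᗮ.starProjection (c j)‖ ^ 2 ≠ 0 := fun h => by
    rw [h, mul_zero] at h2
    exact zero_ne_one h2
  rw [← eq_inv_of_mul_eq_one_left h2]
  simp only [conj_trivial] at h2 ⊢
  rw [sq m, mul_assoc, h2, mul_one]

theorem measurable_dualFamily [FiniteDimensional ℝ E] [MeasurableSpace E] [BorelSpace E] (j : ι) :
    Measurable fun c : ι → E => dualFamily c j := by
  have hg : Continuous fun c : ι → E => gram ℝ c := continuous_matrix fun a b => by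
    simp only [gram_apply]
    fun_prop
  have hinv : ∀ a b, Measurable fun c : ι → E => (gram ℝ c)⁻¹ a b := fun a b => by
    -- Cramer's formula: the adjugate and the determinant are continuous in c, and scalar inversion
    -- is measurable.
    simp only [Matrix.inv_def, Matrix.smul_apply, Ring.inverse_eq_inv', smul_eq_mul]
    exact hg.matrix_det.measurable.inv.mul (hg.matrix_adjugate.matrix_elem a b).measurable
  exact Finset.measurable_sum _ fun k _ => (hinv j k).smul (measurable_pi_apply k)

end DualFamily

/-! ### Gaussian columns: linear independence and the inverse Wishart diagonal -/

section Gaussian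

variable {ι : Type*} [Fintype ι] {E : Type*} [NormedAddCommGroup E]
  [InnerProductSpace ℝ E] [FiniteDimensional ℝ E] [MeasurableSpace E] [BorelSpace E]

theorem measurableSet_linearIndepOn (T : Set ι) :
    MeasurableSet {c : ι → E | LinearIndepOn ℝ c T} := by
  have h : IsOpen {c : T → E | LinearIndependent ℝ c} := isOpen_setOfPred_linearIndependent
  exact (h.preimage (f := fun (c : ι → E) (i : T) => c i) (by fun_prop)).measurableSet

/-- Columns are added one at a time: a freshly sampled column almost surely avoids the span of the
earlier ones, which has codimension at least 3. -/
theorem ae_linearIndependent_pi_stdGaussian (h : Fintype.card ι + 2 ≤ Module.finrank ℝ E) :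
    ∀ᵐ c ∂(Measure.pi fun _ : ι => stdGaussian E), LinearIndependent ℝ c := by
  classical
  have key : ∀ T : Finset ι,
      ∀ᵐ c ∂(Measure.pi fun _ : ι => stdGaussian E), LinearIndepOn ℝ c (T : Set ι) := by
    intro T
    induction T using Finset.induction_on with
    | empty => simp
    | insert a T ha ih =>
      refine ae_pi_of_ae_update a (measurableSet_linearIndepOn _) ?_
      filter_upwards [ih] with x hx
      have hcard : T.card < Fintype.card ι := Finset.card_lt_univ_of_notMem ha
      have hV : Module.finrank ℝ (Submodule.span ℝ (x '' T)) ≤ T.card := by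
        rw [← Finset.coe_image]
        exact (finrank_span_finset_le_card _).trans Finset.card_image_le
      filter_upwards [ae_notMem_submodule_stdGaussian (Submodule.span ℝ (x '' T)) (by omega)]
        with y hy
      have heq : Set.EqOn (Function.update x a y) x (T : Set ι) := fun i hi =>
        Function.update_of_ne (fun hia => ha (by simpa [← hia] using hi)) _ _
      rw [Finset.coe_insert, linearIndepOn_insert (by simpa using ha)]
      refine ⟨(linearIndepOn_congr heq).2 hx, ?_⟩
      rwa [Function.update_self, heq.image_eq]
  filter_upwards [key Finset.univ] with c hc
  simpa using hc

/-- The mean of the diagonal entries of an inverse Wishart matrix. -/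
theorem lintegral_norm_sq_dualFamily [DecidableEq ι]
    (h : Fintype.card ι + 2 ≤ Module.finrank ℝ E) (j : ι) :
    ∫⁻ c, ENNReal.ofReal (‖dualFamily c j‖ ^ 2) ∂(Measure.pi fun _ : ι => stdGaussian E)
      = ENNReal.ofReal (1 / (Module.finrank ℝ E - Fintype.card ι - 1)) := by
  have hm := measurable_dualFamily (E := E) j
  -- With the other columns fixed and independent, their span V has dimension `Fintype.card ι - 1`.
  -- The integral over column j is then an inverse moment that does not depend on V.
  rw [lintegral_pi_eq_lintegral_update j (by fun_prop)]
  have key : ∀ᵐ x ∂(Measure.pi fun _ : ι => stdGaussian E),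
      ∫⁻ y, ENNReal.ofReal (‖dualFamily (Function.update x j y) j‖ ^ 2) ∂(stdGaussian E)
        = ENNReal.ofReal (1 / (Module.finrank ℝ E - Fintype.card ι - 1)) := by
    filter_upwards [ae_linearIndependent_pi_stdGaussian h] with x hx
    set V := Submodule.span ℝ (x '' {j}ᶜ) with hVdef
    have hxo : LinearIndepOn ℝ x ({j}ᶜ : Set ι) := hx.linearIndepOn _
    have hV : Module.finrank ℝ V + 1 = Fintype.card ι := by
      have h1 := finrank_span_eq_card (R := ℝ) hxo
      rw [← Set.image_eq_range] at h1
      have : 0 < Fintype.card ι := Fintype.card_pos_iff.2 ⟨j⟩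
      rw [h1, Fintype.card_compl_set, Set.card_singleton]
      omega
    have h2 := lintegral_inv_norm_sq_orthogonalProjection V (by omega)
    rw [← hV]
    push_cast
    rw [show (Module.finrank ℝ E - (Module.finrank ℝ V + 1) - 1 : ℝ)
      = Module.finrank ℝ E - Module.finrank ℝ V - 2 by ring, ← h2]
    refine lintegral_congr_ae ?_
    filter_upwards [ae_notMem_submodule_stdGaussian V (by omega)] with y hy
    have heq : Set.EqOn (Function.update x j y) x ({j}ᶜ : Set ι) := fun i hi =>
      Function.update_of_ne hi _ _
    have hLI : LinearIndependent ℝ (Function.update x j y) := by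
      rw [← linearIndepOn_univ_iff, ← Set.insert_sdiff_self_of_mem (Set.mem_univ j),
        ← Set.compl_eq_univ_sdiff, linearIndepOn_insert (by simp)]
      refine ⟨(linearIndepOn_congr heq).2 hxo, ?_⟩
      rwa [Function.update_self, heq.image_eq]
    rw [norm_sq_dualFamily hLI, heq.image_eq, Function.update_self, ENNReal.ofReal_inv_of_pos]
    refine pow_pos (norm_pos_iff.2 fun h0 => hy ?_) 2
    rwa [Submodule.starProjection_apply_eq_zero_iff, Submodule.orthogonal_orthogonal] at h0
  rw [lintegral_congr_ae key]
  simp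

end Gaussian

/-! ### Second moments of the dual family -/

section DualMoments

variable {ι κ : Type*} [Fintype ι] [DecidableEq ι] [Fintype κ]

theorem integrable_norm_sq_dualFamily
    (h : Fintype.card ι + 2 ≤ Fintype.card κ) (j : ι) :
    Integrable (fun c : ι → EuclideanSpace ℝ κ => ‖dualFamily c j‖ ^ 2)
      (Measure.pi fun _ : ι => stdGaussian (EuclideanSpace ℝ κ)) := by
  have hm := measurable_dualFamily (E := EuclideanSpace ℝ κ) j
  refine ⟨(hm.norm.pow_const 2).aestronglyMeasurable, ?_⟩
  rw [hasFiniteIntegral_iff_ofReal (ae_of_all _ fun c => sq_nonneg _),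
    lintegral_norm_sq_dualFamily (by simpa using h) j]
  exact ENNReal.ofReal_lt_top

theorem integral_norm_sq_dualFamily
    (h : Fintype.card ι + 2 ≤ Fintype.card κ) (j : ι) :
    ∫ c : ι → EuclideanSpace ℝ κ, ‖dualFamily c j‖ ^ 2
        ∂(Measure.pi fun _ : ι => stdGaussian (EuclideanSpace ℝ κ))
      = 1 / (Fintype.card κ - Fintype.card ι - 1) := by
  have hm := measurable_dualFamily (E := EuclideanSpace ℝ κ) j
  rw [integral_eq_lintegral_of_nonneg_ae (ae_of_all _ fun c => sq_nonneg _)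
    (hm.norm.pow_const 2).aestronglyMeasurable, lintegral_norm_sq_dualFamily (by simpa using h) j,
    ENNReal.toReal_ofReal, finrank_euclideanSpace]
  have h2 : (Fintype.card ι + 2 : ℝ) ≤ Fintype.card κ := by exact_mod_cast h
  rw [finrank_euclideanSpace]
  exact one_div_nonneg.2 (by linarith)

theorem memLp_dualFamily_apply
    (h : Fintype.card ι + 2 ≤ Fintype.card κ) (j : ι) (a : κ) :
    MemLp (fun c : ι → EuclideanSpace ℝ κ => dualFamily c j a) 2
      (Measure.pi fun _ : ι => stdGaussian (EuclideanSpace ℝ κ)) := by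
  have hm := measurable_dualFamily (E := EuclideanSpace ℝ κ) j
  have h1 : MemLp (fun c : ι → EuclideanSpace ℝ κ => dualFamily c j) 2
      (Measure.pi fun _ : ι => stdGaussian (EuclideanSpace ℝ κ)) :=
    (memLp_two_iff_integrable_sq_norm hm.aestronglyMeasurable).2
      (integrable_norm_sq_dualFamily h j)
  refine h1.mono (by fun_prop) (ae_of_all _ fun c => ?_)
  exact PiLp.norm_apply_le (dualFamily c j) a

/-- The dual family is equivariant under isometries, and applying `L` to every column preserves the
Gaussian law. -/
theorem integral_comp_dualFamily_linearIsometryEquiv (j : ι)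
    (L : EuclideanSpace ℝ κ ≃ₗᵢ[ℝ] EuclideanSpace ℝ κ) (f : EuclideanSpace ℝ κ → ℝ) :
    ∫ c : ι → EuclideanSpace ℝ κ, f (L (dualFamily c j))
        ∂(Measure.pi fun _ : ι => stdGaussian (EuclideanSpace ℝ κ))
      = ∫ c : ι → EuclideanSpace ℝ κ, f (dualFamily c j)
        ∂(Measure.pi fun _ : ι => stdGaussian (EuclideanSpace ℝ κ)) := by
  have hL : MeasurePreserving L (stdGaussian (EuclideanSpace ℝ κ))
      (stdGaussian (EuclideanSpace ℝ κ)) := ⟨by fun_prop, stdGaussian_map L⟩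
  have hmp := measurePreserving_pi (fun _ : ι => stdGaussian (EuclideanSpace ℝ κ))
    (fun _ : ι => stdGaussian (EuclideanSpace ℝ κ)) (f := fun _ => L) fun _ => hL
  have hemb : MeasurableEmbedding
      (fun (c : ι → EuclideanSpace ℝ κ) (k : ι) => L (c k)) :=
    (MeasurableEquiv.piCongrRight fun _ : ι =>
      L.toHomeomorph.toMeasurableEquiv).measurableEmbedding
  rw [← hmp.integral_comp hemb (fun c => f (dualFamily c j))]
  simp_rw [dualFamily_linearIsometryEquiv_comp]

variable [DecidableEq κ]

/-- Isotropy from two kinds of isometries: coordinate swaps make all diagonal moments equal, hence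
each is E‖w‖² / n, and flipping the sign of one coordinate makes the off-diagonal moments vanish. -/
theorem integral_dualFamily_mul
    (h : Fintype.card ι + 2 ≤ Fintype.card κ) (j : ι) (a b : κ) :
    ∫ c : ι → EuclideanSpace ℝ κ, dualFamily c j a * dualFamily c j b
        ∂(Measure.pi fun _ : ι => stdGaussian (EuclideanSpace ℝ κ))
      = if a = b then 1 / ((Fintype.card κ : ℝ) * (Fintype.card κ - Fintype.card ι - 1)) else 0 := by
  split_ifs with hab
  · subst hab
    have hperm : ∀ b : κ, ∫ c : ι → EuclideanSpace ℝ κ, dualFamily c j b * dualFamily c j b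
        ∂(Measure.pi fun _ : ι => stdGaussian (EuclideanSpace ℝ κ))
      = ∫ c : ι → EuclideanSpace ℝ κ, dualFamily c j a * dualFamily c j a
        ∂(Measure.pi fun _ : ι => stdGaussian (EuclideanSpace ℝ κ)) := by
      intro b
      rw [← integral_comp_dualFamily_linearIsometryEquiv j
        (LinearIsometryEquiv.piLpCongrLeft 2 ℝ ℝ (Equiv.swap a b)) (fun x => x b * x b)]
      simp [LinearIsometryEquiv.piLpCongrLeft_apply, Equiv.piCongrLeft'_apply]
    have hsum := integral_norm_sq_dualFamily h j
    simp_rw [EuclideanSpace.real_norm_sq_eq, sq] at hsum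
    rw [integral_finsetSum] at hsum
    swap
    · exact fun i _ =>
        (memLp_dualFamily_apply h j i).integrable_mul (memLp_dualFamily_apply h j i)
    simp_rw [hperm] at hsum
    rw [Finset.sum_const, Finset.card_univ, nsmul_eq_mul] at hsum
    have h0 : (Fintype.card κ : ℝ) ≠ 0 := by
      have : Fintype.card κ ≠ 0 := by omega
      exact_mod_cast this
    rw [one_div, mul_inv, ← one_div (Fintype.card κ - Fintype.card ι - 1 : ℝ), ← hsum,
      inv_mul_cancel_left₀ h0]
  · have hflip := integral_comp_dualFamily_linearIsometryEquiv j
      (LinearIsometryEquiv.piLpCongrRight 2 fun i : κ =>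
        if i = a then LinearIsometryEquiv.neg ℝ (E := ℝ) else LinearIsometryEquiv.refl ℝ ℝ)
      (fun x => x a * x b)
    simp only [LinearIsometryEquiv.piLpCongrRight_apply, if_true, if_neg (Ne.symm hab)] at hflip
    simp only [LinearIsometryEquiv.coe_neg, LinearIsometryEquiv.coe_refl, id, neg_mul,
      integral_neg] at hflip
    linarith

end DualMoments

/-! ### From independent Gaussian rows to independent Gaussian columns -/

section Columns

variable {ι κ : Type*} [Fintype ι] [Fintype κ]

theorem iIndepFun_pi_pi_gaussianReal :
    iIndepFun (fun (q : ι × κ) (r : ι → κ → ℝ) => r q.1 q.2)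
      (Measure.pi fun _ : ι => Measure.pi fun _ : κ => gaussianReal 0 1) := by
  have := iIndepFun_uncurry_infinitePi' (X := fun (_ : ι) (_ : κ) (x : ℝ) => x)
    (fun _ _ => gaussianReal 0 1) (fun _ _ => measurable_id)
  simpa only [Measure.infinitePi_eq_pi] using this

theorem map_eval_pi_pi_gaussianReal (i : ι) (j : κ) :
    (Measure.pi fun _ : ι => Measure.pi fun _ : κ => gaussianReal 0 1).map (fun r => r i j)
      = gaussianReal 0 1 :=
  ((measurePreserving_eval (fun _ : κ => gaussianReal 0 1) j).comp
    (measurePreserving_eval (fun _ : ι => Measure.pi fun _ : κ => gaussianReal 0 1) i)).map_eq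

/-- Both sides are curryings of the same family of independent standard normal entries indexed by
pairs. -/
theorem map_flip_pi_gaussianReal :
    (Measure.pi fun _ : κ => Measure.pi fun _ : ι => gaussianReal 0 1).map
        (fun r j i => r i j)
      = Measure.pi fun _ : ι => Measure.pi fun _ : κ => gaussianReal 0 1 := by
  have h1 := (iIndepFun_pi_pi_gaussianReal (ι := κ) (κ := ι)).precomp (g := Prod.swap)
    Prod.swap_injective
  have h2 := iIndepFun_pi_pi_gaussianReal (ι := ι) (κ := κ)
  have hm1 : ∀ i : ι × κ, Measurable fun r : κ → ι → ℝ => r i.swap.1 i.swap.2 := fun i =>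
    (measurable_pi_apply _).comp (measurable_pi_apply _)
  have hm2 : ∀ i : ι × κ, Measurable fun r : ι → κ → ℝ => r i.1 i.2 := fun i =>
    (measurable_pi_apply _).comp (measurable_pi_apply _)
  replace h1 := (iIndepFun_iff_map_fun_eq_pi_map fun i => (hm1 i).aemeasurable).1 h1
  replace h2 := (iIndepFun_iff_map_fun_eq_pi_map fun i => (hm2 i).aemeasurable).1 h2
  simp only [Prod.fst_swap, Prod.snd_swap, map_eval_pi_pi_gaussianReal] at h1 h2
  have h3 := congrArg (Measure.map fun (x : ι × κ → ℝ) j i => x (j, i)) (h1.trans h2.symm)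
  rw [Measure.map_map (by fun_prop) (by fun_prop),
    Measure.map_map (by fun_prop) (by fun_prop)] at h3
  simpa [Function.comp_def] using h3

theorem pi_stdGaussian_eq_map :
    (Measure.pi fun _ : κ => stdGaussian (EuclideanSpace ℝ ι))
      = (Measure.pi fun _ : κ => Measure.pi fun _ : ι => gaussianReal 0 1).map
        (fun r i => WithLp.toLp 2 (r i)) := by
  rw [← map_pi_eq_stdGaussian, Measure.pi_map_pi fun _ => by fun_prop]

theorem hasLaw_columns {Ω : Type*} {mΩ : MeasurableSpace Ω} {Q : Measure Ω} [DecidableEq ι]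
    {A : Ω → Matrix κ ι ℝ}
    (hind : iIndepFun (fun (i : κ) (ω : Ω) => WithLp.toLp 2 (A ω i)) Q)
    (hlaw : ∀ i, HasLaw (fun ω => WithLp.toLp 2 (A ω i))
      (multivariateGaussian (0 : EuclideanSpace ℝ ι) 1) Q) :
    HasLaw (fun ω (j : ι) => WithLp.toLp 2 (fun i => A ω i j))
      (Measure.pi fun _ : ι => stdGaussian (EuclideanSpace ℝ κ)) Q := by
  have hrows : HasLaw (fun ω (i : κ) => WithLp.toLp 2 (A ω i))
      (Measure.pi fun _ : κ => stdGaussian (EuclideanSpace ℝ ι)) Q := by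
    have hm : ∀ i, AEMeasurable (fun ω => WithLp.toLp 2 (A ω i)) Q := fun i =>
      (hlaw i).aemeasurable
    refine ⟨aemeasurable_pi_lambda _ hm, ?_⟩
    have := hind.isProbabilityMeasure
    rw [(iIndepFun_iff_map_fun_eq_pi_map hm).1 hind]
    simp_rw [(hlaw _).map_eq, multivariateGaussian_zero_one]
  have hcol : HasLaw (fun (r : κ → EuclideanSpace ℝ ι) (j : ι) => WithLp.toLp 2 fun i => r i j)
      (Measure.pi fun _ : ι => stdGaussian (EuclideanSpace ℝ κ))
      (Measure.pi fun _ : κ => stdGaussian (EuclideanSpace ℝ ι)) := by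
    have hmeas : Measurable fun (r : κ → EuclideanSpace ℝ ι) (j : ι) =>
        WithLp.toLp 2 fun i => r i j :=
      measurable_pi_lambda _ fun j => (WithLp.measurable_toLp 2 _).comp <|
        measurable_pi_lambda _ fun i => (measurable_pi_apply j).comp <|
          (WithLp.measurable_ofLp 2 _).comp (measurable_pi_apply i)
    refine ⟨hmeas.aemeasurable, ?_⟩
    rw [pi_stdGaussian_eq_map, pi_stdGaussian_eq_map, ← map_flip_pi_gaussianReal,
      Measure.map_map hmeas (by fun_prop), Measure.map_map (by fun_prop) (by fun_prop)]
    rfl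
  exact hcol.comp hrows

end Columns

/-! ### The estimator as least squares -/

section Estimator

open PartialLMMSE

/-- With G = Bᵀ B, both products of the two matrices collapse to the orthogonal projector B G⁻¹ Bᵀ
onto the column space of B. -/
theorem isMoorePenrose_mul_transpose {m k : Type*} [Fintype m] [Fintype k] [DecidableEq k]
    {B : Matrix m k ℝ} (hB : IsUnit (Bᵀ * B).det) :
    IsMoorePenrose (B * Bᵀ) (B * (Bᵀ * B)⁻¹ * (Bᵀ * B)⁻¹ * Bᵀ) := by
  set G := Bᵀ * B with hG
  have hGt : (G⁻¹)ᵀ = G⁻¹ := by rw [transpose_nonsing_inv, hG, transpose_mul, transpose_transpose]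
  have h1 : B * Bᵀ * (B * G⁻¹ * G⁻¹ * Bᵀ) = B * G⁻¹ * Bᵀ := by
    calc B * Bᵀ * (B * G⁻¹ * G⁻¹ * Bᵀ) = B * (G * G⁻¹) * G⁻¹ * Bᵀ := by
          rw [hG]; simp only [Matrix.mul_assoc]
      _ = B * G⁻¹ * Bᵀ := by rw [mul_nonsing_inv _ hB, Matrix.mul_one]
  have h2 : B * G⁻¹ * G⁻¹ * Bᵀ * (B * Bᵀ) = B * G⁻¹ * Bᵀ := by
    calc B * G⁻¹ * G⁻¹ * Bᵀ * (B * Bᵀ) = B * G⁻¹ * (G⁻¹ * G) * Bᵀ := by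
          rw [hG]; simp only [Matrix.mul_assoc]
      _ = B * G⁻¹ * Bᵀ := by rw [nonsing_inv_mul _ hB, Matrix.mul_one]
  have h3 : (B * G⁻¹ * Bᵀ)ᵀ = B * G⁻¹ * Bᵀ := by
    rw [transpose_mul, transpose_mul, hGt, transpose_transpose, Matrix.mul_assoc]
  refine ⟨?_, ?_, by rw [h1, h3], by rw [h2, h3]⟩
  · rw [h1]
    calc B * G⁻¹ * Bᵀ * (B * Bᵀ) = B * (G⁻¹ * G) * Bᵀ := by
          rw [hG]; simp only [Matrix.mul_assoc]
      _ = B * Bᵀ := by rw [nonsing_inv_mul _ hB, Matrix.mul_one]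
  · rw [h2]
    calc B * G⁻¹ * Bᵀ * (B * G⁻¹ * G⁻¹ * Bᵀ) = B * (G⁻¹ * G) * G⁻¹ * G⁻¹ * Bᵀ := by
          rw [hG]; simp only [Matrix.mul_assoc]
      _ = B * G⁻¹ * G⁻¹ * Bᵀ := by rw [nonsing_inv_mul _ hB, Matrix.mul_one]

theorem lmmse_one_zero {m k : Type*} [Fintype m] [Fintype k] [DecidableEq k]
    {B : Matrix m k ℝ} (hB : IsUnit (Bᵀ * B).det) :
    lmmse 1 0 B = (Bᵀ * B)⁻¹ * Bᵀ := by
  rw [lmmse, Matrix.one_mul, Matrix.mul_one, add_zero,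
    (pinv_spec _).unique (isMoorePenrose_mul_transpose hB)]
  calc Bᵀ * (B * (Bᵀ * B)⁻¹ * (Bᵀ * B)⁻¹ * Bᵀ)
      = (Bᵀ * B) * (Bᵀ * B)⁻¹ * (Bᵀ * B)⁻¹ * Bᵀ := by simp only [Matrix.mul_assoc]
    _ = _ := by rw [mul_nonsing_inv _ hB, Matrix.one_mul]

variable {p n : ℕ} {S : Finset (Fin p)} {A : Matrix (Fin n) (Fin p) ℝ}
  {c : Fin p → EuclideanSpace ℝ (Fin n)}

theorem partialLMMSE_apply (hA : ∀ i j, c j i = A i j)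
    (hc : LinearIndependent ℝ fun j : S => c j) (j : S) (a : Fin n) :
    partialLMMSE S A j a = dualFamily (fun j : S => c j) j a := by
  set B : Matrix (Fin n) S ℝ := A.submatrix id (fun i : S => (i : Fin p)) with hBdef
  have hG : Bᵀ * B = gram ℝ (fun j : S => c j) := by
    ext k l
    simp [gram_apply, Matrix.mul_apply, PiLp.inner_apply, hBdef, hA, mul_comm]
  have hB : IsUnit (Bᵀ * B).det := by
    rw [hG]
    exact (det_gram_ne_zero_iff_linearIndependent.2 hc).isUnit
  rw [partialLMMSE, lmmse_one_zero hB, hG, Matrix.mul_apply, dualFamily]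
  simp [hBdef, hA]

theorem partialLMMSE_mul_apply (hA : ∀ i j, c j i = A i j)
    (hc : LinearIndependent ℝ fun j : S => c j) (j k : S) :
    (partialLMMSE S A * A) j k = if j = k then 1 else 0 := by
  rw [← inner_dualFamily hc, Matrix.mul_apply]
  simp [partialLMMSE_apply hA hc, PiLp.inner_apply, hA, mul_comm]

end Estimator

/-! ### The mean squared error for fixed regressors -/

section MeanSquaredError

theorem integral_sq_sum_mul {Ω ι : Type*} [Fintype ι] {mΩ : MeasurableSpace Ω} {P : Measure Ω}
    {z : ι → Ω → ℝ} (hz : ∀ i, MemLp (z i) 2 P) (b : ι → ℝ) :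
    ∫ ω, (∑ i, b i * z i ω) ^ 2 ∂P = ∑ i, ∑ j, b i * b j * ∫ ω, z i ω * z j ω ∂P := by
  have h : ∀ ω, (∑ i, b i * z i ω) ^ 2 = ∑ i, ∑ j, b i * b j * (z i ω * z j ω) := fun ω => by
    rw [sq, Finset.sum_mul_sum]
    refine Finset.sum_congr rfl fun i _ => Finset.sum_congr rfl fun j _ => ?_
    ring
  have hi : ∀ i j, Integrable (fun ω => z i ω * z j ω) P := fun i j =>
    (hz i).integrable_mul (hz j)
  simp_rw [h]
  rw [integral_finsetSum _ fun i _ => integrable_finsetSum _ fun j _ => (hi i j).const_mul _]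
  refine Finset.sum_congr rfl fun i _ => ?_
  rw [integral_finsetSum _ fun j _ => (hi i j).const_mul _]
  simp_rw [integral_const_mul]

end MeanSquaredError

namespace PartialLMMSE.LinearSystem

variable {p n : ℕ} (M : LinearSystem.{u₁, u₂} p n) (S : Finset (Fin p))

theorem sqError_eq_sum (A : Matrix (Fin n) (Fin p) ℝ) (W : Matrix S (Fin n) ℝ) (ω : M.Ω) :
    M.sqError S A W ω
      = ∑ j : S, (M.x ω j - (∑ k, (W * A) j k * M.x ω k + ∑ a, W j a * M.v ω a)) ^ 2 := by
  rw [sqError, EuclideanSpace.real_norm_sq_eq]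
  refine Finset.sum_congr rfl fun j _ => ?_
  simp only [xSub, y, Pi.sub_apply, Matrix.mulVec_add, Pi.add_apply, Matrix.mulVec_mulVec]
  rfl

theorem integrable_sqError (A : Matrix (Fin n) (Fin p) ℝ) (W : Matrix S (Fin n) ℝ) :
    Integrable (M.sqError S A W) M.P := by
  have h : M.sqError S A W = fun ω =>
      ∑ j : S, (M.x ω j - (∑ k, (W * A) j k * M.x ω k + ∑ a, W j a * M.v ω a)) ^ 2 :=
    funext fun ω => M.sqError_eq_sum S A W ω
  rw [h]
  refine integrable_finsetSum _ fun j _ => MemLp.integrable_sq ?_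
  exact (M.memLp_x j).sub ((memLp_finsetSum _ fun k _ => (M.memLp_x k).const_mul _).add
    (memLp_finsetSum _ fun a _ => (M.memLp_v a).const_mul _))

theorem covXSub_apply (T : Finset (Fin p)) (k l : T) :
    M.covXSub T k l = ∫ ω, M.x ω k * M.x ω l ∂M.P := by
  rw [covXSub, crossCov, Matrix.of_apply]
  simp only [xSub]
  rw [covariance_eq_sub (M.memLp_x k) (M.memLp_x l), M.mean_x, M.mean_x]
  simp

theorem covV_apply (a b : Fin n) : M.covV a b = ∫ ω, M.v ω a * M.v ω b ∂M.P := by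
  rw [covV, crossCov, Matrix.of_apply, covariance_eq_sub (M.memLp_v a) (M.memLp_v b), M.mean_v,
    M.mean_v]
  simp

theorem integral_x_mul_v (k : Fin p) (a : Fin n) : ∫ ω, M.x ω k * M.v ω a ∂M.P = 0 := by
  have h : crossCov M.P M.x M.v k a = 0 := by rw [M.uncorrelated]; rfl
  rw [crossCov, Matrix.of_apply, covariance_eq_sub (M.memLp_x k) (M.memLp_v a), M.mean_x] at h
  simpa using h

/-- The mean squared error of an unbiased linear estimator, one with `W A_S = 1`. -/
theorem mseS_eq_of_mul_eq {A : Matrix (Fin n) (Fin p) ℝ} {W : Matrix S (Fin n) ℝ}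
    (hW : ∀ j k : S, (W * A) j k = if j = k then 1 else 0) :
    M.mseS S A W = ∑ j : S,
      (∑ k : (Sᶜ : Finset (Fin p)), ∑ l : (Sᶜ : Finset (Fin p)),
          (W * A) j k * (W * A) j l * M.covXSub Sᶜ k l
        + ∑ a, ∑ b, W j a * W j b * M.covV a b) := by
  -- The unknowns outside `S` and the noise are stacked into one disturbance vector, whose mixed
  -- second moments vanish.
  let z : (Sᶜ : Finset (Fin p)) ⊕ Fin n → M.Ω → ℝ :=
    Sum.elim (fun k ω => M.x ω k) (fun a ω => M.v ω a)
  have hz : ∀ i, MemLp (z i) 2 M.P := by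
    rintro (k | a)
    · exact M.memLp_x k
    · exact M.memLp_v a
  let b : S → (Sᶜ : Finset (Fin p)) ⊕ Fin n → ℝ := fun j =>
    Sum.elim (fun k => (W * A) j k) (fun a => W j a)
  have herr : ∀ ω, M.sqError S A W ω = ∑ j : S, (∑ i, b j i * z i ω) ^ 2 := by
    intro ω
    rw [sqError_eq_sum]
    refine Finset.sum_congr rfl fun j _ => ?_
    -- As `W` is a left inverse on the columns in `S`, the estimate contains exactly x_j, and the
    -- error is minus the disturbance term.
    have h1 : ∑ k, (W * A) j k * M.x ω k
        = M.x ω j + ∑ k : (Sᶜ : Finset (Fin p)), (W * A) j k * M.x ω k := by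
      rw [← Finset.sum_add_sum_compl S, ← Finset.sum_coe_sort S, ← Finset.sum_coe_sort Sᶜ]
      simp [hW]
    rw [h1, Fintype.sum_sum_type]
    simp only [b, z, Sum.elim_inl, Sum.elim_inr]
    ring
  rw [mseS]
  simp_rw [herr]
  rw [integral_finsetSum]
  swap
  · exact fun j _ => (memLp_finsetSum _ fun i _ => (hz i).const_mul _).integrable_sq
  refine Finset.sum_congr rfl fun j _ => ?_
  have hvx : ∀ (a : Fin n) (k : Fin p), ∫ ω, M.v ω a * M.x ω k ∂M.P = 0 := fun a k => by
    rw [← M.integral_x_mul_v k a]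
    simp_rw [mul_comm]
  rw [integral_sq_sum_mul hz]
  simp only [Fintype.sum_sum_type, b, z, Sum.elim_inl, Sum.elim_inr, integral_x_mul_v, hvx,
    mul_zero, Finset.sum_const_zero, add_zero, zero_add, covXSub_apply, covV_apply]

end PartialLMMSE.LinearSystem

/-! ### Second moments of the Gaussian entries -/

section Entries

theorem measurable_toLp_apply {ι κ : Type*} :
    Measurable fun (r : ι → κ → ℝ) (k : ι) => (WithLp.toLp 2 (r k) : EuclideanSpace ℝ κ) := by
  fun_prop

variable {ι κ : Type*} [Fintype ι] [Fintype κ]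

theorem measurePreserving_eval_apply_pi_stdGaussian (k : ι) (a : κ) :
    MeasurePreserving (fun c : ι → EuclideanSpace ℝ κ => c k a)
      (Measure.pi fun _ : ι => stdGaussian (EuclideanSpace ℝ κ)) (gaussianReal 0 1) := by
  refine ⟨by fun_prop, ?_⟩
  rw [pi_stdGaussian_eq_map, Measure.map_map (by fun_prop) measurable_toLp_apply]
  exact map_eval_pi_pi_gaussianReal k a

theorem memLp_eval_apply_pi_stdGaussian (k : ι) (a : κ) :
    MemLp (fun c : ι → EuclideanSpace ℝ κ => c k a) 2
      (Measure.pi fun _ : ι => stdGaussian (EuclideanSpace ℝ κ)) :=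
  (memLp_id_gaussianReal 2).comp_measurePreserving
    (measurePreserving_eval_apply_pi_stdGaussian k a)

variable [DecidableEq ι] [DecidableEq κ]

theorem integral_apply_mul_apply_pi_stdGaussian (k l : ι) (a b : κ) :
    ∫ c : ι → EuclideanSpace ℝ κ, c k a * c l b
        ∂(Measure.pi fun _ : ι => stdGaussian (EuclideanSpace ℝ κ))
      = if k = l then (if a = b then 1 else 0) else 0 := by
  rw [pi_stdGaussian_eq_map, integral_map measurable_toLp_apply.aemeasurable (by fun_prop)]
  have hmp : ∀ (k : ι) (a : κ), MeasurePreserving (fun r : ι → κ → ℝ => r k a)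
      (Measure.pi fun _ : ι => Measure.pi fun _ : κ => gaussianReal 0 1) (gaussianReal 0 1) :=
    fun k a => ⟨(measurable_pi_apply a).comp (measurable_pi_apply k),
      map_eval_pi_pi_gaussianReal k a⟩
  -- Equal positions give the variance 1; distinct positions give independent factors of mean zero.
  by_cases h : (k, a) = (l, b)
  · obtain ⟨rfl, rfl⟩ := Prod.mk.inj h
    simp only [if_true]
    rw [← integral_map (f := fun x : ℝ => x * x) (hmp k a).aemeasurable (by fun_prop),
      (hmp k a).map_eq]
    have := variance_fun_id_gaussianReal (μ := 0) (v := 1)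
    rw [variance_eq_integral (by fun_prop)] at this
    simpa [sq] using this
  · have hind := (iIndepFun_pi_pi_gaussianReal (ι := ι) (κ := κ)).indepFun h
    rw [hind.integral_fun_mul_eq_mul_integral (hmp k a).measurable.aestronglyMeasurable
      (hmp l b).measurable.aestronglyMeasurable]
    have h0 : ∫ r : ι → κ → ℝ, r k a
        ∂(Measure.pi fun _ : ι => Measure.pi fun _ : κ => gaussianReal 0 1) = 0 := by
      rw [← integral_map (f := fun x : ℝ => x) (hmp k a).aemeasurable (by fun_prop),
        (hmp k a).map_eq]
      simp
    have hne : ¬ (k = l ∧ a = b) := fun hkl => h (by rw [hkl.1, hkl.2])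
    rw [h0, zero_mul]
    split_ifs <;> simp_all

end Entries

/-! ### Averaging over the columns in S and in its complement -/

section Blocks

variable {ι κ : Type*} [Fintype ι] [Fintype κ]

theorem measurePreserving_restrict_pi_stdGaussian (S : Finset ι) :
    MeasurePreserving (fun (c : ι → EuclideanSpace ℝ κ) (j : S) => c j)
      (Measure.pi fun _ : ι => stdGaussian (EuclideanSpace ℝ κ))
      (Measure.pi fun _ : S => stdGaussian (EuclideanSpace ℝ κ)) := by
  refine ⟨by fun_prop, ?_⟩
  have h := (iIndepFun_pi (μ := fun _ : ι => stdGaussian (EuclideanSpace ℝ κ))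
    (X := fun _ x => x) fun _ => aemeasurable_id).precomp (g := fun j : S => (j : ι))
      Subtype.val_injective
  have hm : ∀ j : S, AEMeasurable (fun c : ι → EuclideanSpace ℝ κ => c j)
      (Measure.pi fun _ : ι => stdGaussian (EuclideanSpace ℝ κ)) := fun j =>
    (measurable_pi_apply (j : ι)).aemeasurable
  have h2 := (iIndepFun_iff_map_fun_eq_pi_map hm).1 h
  rw [h2]
  congr 1
  ext1 j
  exact (measurePreserving_eval (fun _ : ι => stdGaussian (EuclideanSpace ℝ κ)) (j : ι)).map_eq

variable [DecidableEq ι]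

theorem indepFun_dualFamily_restrict (S : Finset ι) (j : S) :
    IndepFun (fun c : ι → EuclideanSpace ℝ κ => dualFamily (fun k : S => c k) j)
      (fun (c : ι → EuclideanSpace ℝ κ) (k : (Sᶜ : Finset ι)) => c k)
      (Measure.pi fun _ : ι => stdGaussian (EuclideanSpace ℝ κ)) := by
  have h := iIndepFun_pi (μ := fun _ : ι => stdGaussian (EuclideanSpace ℝ κ))
    (X := fun _ x => x) fun _ => aemeasurable_id
  exact (h.indepFun_finset S Sᶜ disjoint_compl_right fun i => by fun_prop).comp
    (measurable_dualFamily j) measurable_id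

variable {S : Finset ι}

theorem memLp_dualFamily_restrict_apply (h : S.card + 2 ≤ Fintype.card κ) (j : S) (a : κ) :
    MemLp (fun c : ι → EuclideanSpace ℝ κ => dualFamily (fun k : S => c k) j a) 2
      (Measure.pi fun _ : ι => stdGaussian (EuclideanSpace ℝ κ)) :=
  (memLp_dualFamily_apply (by simpa using h) j a).comp_measurePreserving
    (measurePreserving_restrict_pi_stdGaussian S)

variable [DecidableEq κ]

theorem integral_dualFamily_restrict_mul (h : S.card + 2 ≤ Fintype.card κ) (j : S) (a b : κ) :
    ∫ c : ι → EuclideanSpace ℝ κ,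
        dualFamily (fun k : S => c k) j a * dualFamily (fun k : S => c k) j b
        ∂(Measure.pi fun _ : ι => stdGaussian (EuclideanSpace ℝ κ))
      = if a = b then 1 / ((Fintype.card κ : ℝ) * (Fintype.card κ - S.card - 1)) else 0 := by
  have h2 := integral_dualFamily_mul (ι := S) (κ := κ) (by simpa using h) j a b
  rw [← (measurePreserving_restrict_pi_stdGaussian S).map_eq, integral_map
    (measurePreserving_restrict_pi_stdGaussian S).aemeasurable, Fintype.card_coe] at h2
  · exact h2
  · have := measurable_dualFamily (E := EuclideanSpace ℝ κ) j
    fun_prop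

/-- The dual family uses only columns in `S`, so it is independent of the columns `k` and `l`, and
the moment factors. -/
theorem integrable_and_integral_dualFamily_mul_mul (h : S.card + 2 ≤ Fintype.card κ) (j : S)
    (k l : (Sᶜ : Finset ι)) (a b : κ) :
    Integrable (fun c : ι → EuclideanSpace ℝ κ =>
        (dualFamily (fun k : S => c k) j a * dualFamily (fun k : S => c k) j b) * (c k a * c l b))
        (Measure.pi fun _ : ι => stdGaussian (EuclideanSpace ℝ κ)) ∧
      ∫ c : ι → EuclideanSpace ℝ κ,
        (dualFamily (fun k : S => c k) j a * dualFamily (fun k : S => c k) j b) * (c k a * c l b)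
        ∂(Measure.pi fun _ : ι => stdGaussian (EuclideanSpace ℝ κ))
      = if k = l then
          (if a = b then 1 / ((Fintype.card κ : ℝ) * (Fintype.card κ - S.card - 1)) else 0)
        else 0 := by
  have hind : IndepFun
      (fun c : ι → EuclideanSpace ℝ κ =>
        dualFamily (fun k : S => c k) j a * dualFamily (fun k : S => c k) j b)
      (fun c : ι → EuclideanSpace ℝ κ => c k a * c l b)
      (Measure.pi fun _ : ι => stdGaussian (EuclideanSpace ℝ κ)) :=
    (indepFun_dualFamily_restrict S j).comp (φ := fun w : EuclideanSpace ℝ κ => w a * w b)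
      (ψ := fun c : (Sᶜ : Finset ι) → EuclideanSpace ℝ κ => c k a * c l b)
      (by fun_prop) (by fun_prop)
  have h1 := (memLp_dualFamily_restrict_apply h j a).integrable_mul
    (memLp_dualFamily_restrict_apply h j b)
  have h2 := (memLp_eval_apply_pi_stdGaussian (κ := κ) (k : ι) a).integrable_mul
    (memLp_eval_apply_pi_stdGaussian (l : ι) b)
  refine ⟨hind.integrable_mul h1 h2, ?_⟩
  rw [hind.integral_fun_mul_eq_mul_integral h1.aestronglyMeasurable h2.aestronglyMeasurable,
    integral_dualFamily_restrict_mul h, integral_apply_mul_apply_pi_stdGaussian]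
  simp only [Subtype.coe_inj]
  split_ifs <;> simp

/-- Mean over Gaussian columns `c` of the conditional mean squared error that the columns outside
`S` and the noise cause. -/
theorem integrable_and_integral_dualFamily_quadratic (h : S.card + 2 ≤ Fintype.card κ)
    (K : Matrix (Sᶜ : Finset ι) (Sᶜ : Finset ι) ℝ) (V : Matrix κ κ ℝ) :
    Integrable (fun c : ι → EuclideanSpace ℝ κ => ∑ j : S,
        (∑ k : (Sᶜ : Finset ι), ∑ l : (Sᶜ : Finset ι),
            (∑ a, dualFamily (fun k : S => c k) j a * c k a)
            * (∑ a, dualFamily (fun k : S => c k) j a * c l a) * K k l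
          + ∑ a, ∑ b, dualFamily (fun k : S => c k) j a * dualFamily (fun k : S => c k) j b
            * V a b))
        (Measure.pi fun _ : ι => stdGaussian (EuclideanSpace ℝ κ)) ∧
      ∫ c : ι → EuclideanSpace ℝ κ, ∑ j : S,
        (∑ k : (Sᶜ : Finset ι), ∑ l : (Sᶜ : Finset ι),
            (∑ a, dualFamily (fun k : S => c k) j a * c k a)
            * (∑ a, dualFamily (fun k : S => c k) j a * c l a) * K k l
          + ∑ a, ∑ b, dualFamily (fun k : S => c k) j a * dualFamily (fun k : S => c k) j b
            * V a b)
        ∂(Measure.pi fun _ : ι => stdGaussian (EuclideanSpace ℝ κ))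
      = S.card / (Fintype.card κ - S.card - 1) * (K.trace + V.trace / Fintype.card κ) := by
  have hV := fun (j : S) (a b : κ) => (memLp_dualFamily_restrict_apply h j a).integrable_mul
    (memLp_dualFamily_restrict_apply h j b)
  have hK := integrable_and_integral_dualFamily_mul_mul h
  -- Fully expanded, each summand is a constant times a product of independent factors, so it can be
  -- integrated separately.
  have hexp : ∀ (c : ι → EuclideanSpace ℝ κ) (j : S) (k l : (Sᶜ : Finset ι)),
      (∑ a, dualFamily (fun k : S => c k) j a * c k a)
            * (∑ a, dualFamily (fun k : S => c k) j a * c l a) * K k l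
        = ∑ a, ∑ b, (dualFamily (fun k : S => c k) j a * dualFamily (fun k : S => c k) j b)
            * (c k a * c l b) * K k l := by
    intro c j k l
    rw [Finset.sum_mul_sum, Finset.sum_mul]
    refine Finset.sum_congr rfl fun a _ => ?_
    rw [Finset.sum_mul]
    exact Finset.sum_congr rfl fun b _ => by ring
  simp_rw [hexp]
  have iK : ∀ (j : S) (k l : (Sᶜ : Finset ι)) (a b : κ), Integrable
      (fun c : ι → EuclideanSpace ℝ κ =>
        (dualFamily (fun k : S => c k) j a * dualFamily (fun k : S => c k) j b)
            * (c k a * c l b) * K k l)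
        (Measure.pi fun _ : ι => stdGaussian (EuclideanSpace ℝ κ)) :=
    fun j k l a b => (hK j k l a b).1.mul_const _
  have iV : ∀ (j : S) (a b : κ), Integrable (fun c : ι → EuclideanSpace ℝ κ =>
        dualFamily (fun k : S => c k) j a * dualFamily (fun k : S => c k) j b * V a b)
        (Measure.pi fun _ : ι => stdGaussian (EuclideanSpace ℝ κ)) :=
    fun j a b => (hV j a b).mul_const _
  have iK1 := fun j k l a => integrable_finsetSum Finset.univ fun b _ => iK j k l a b
  have iK2 := fun j k l => integrable_finsetSum Finset.univ fun a _ => iK1 j k l a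
  have iK3 := fun j k => integrable_finsetSum Finset.univ fun l _ => iK2 j k l
  have iK4 := fun j => integrable_finsetSum Finset.univ fun k _ => iK3 j k
  have iV1 := fun j a => integrable_finsetSum Finset.univ fun b _ => iV j a b
  have iV2 := fun j => integrable_finsetSum Finset.univ fun a _ => iV1 j a
  refine ⟨integrable_finsetSum _ fun j _ => (iK4 j).add (iV2 j), ?_⟩
  rw [integral_finsetSum]
  swap
  · exact fun j _ => (iK4 j).add (iV2 j)
  have hj : ∀ j : S, ∫ c : ι → EuclideanSpace ℝ κ,
        (∑ k : (Sᶜ : Finset ι), ∑ l : (Sᶜ : Finset ι), ∑ a, ∑ b,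
            (dualFamily (fun k : S => c k) j a * dualFamily (fun k : S => c k) j b)
            * (c k a * c l b) * K k l
          + ∑ a, ∑ b, dualFamily (fun k : S => c k) j a * dualFamily (fun k : S => c k) j b
            * V a b)
        ∂(Measure.pi fun _ : ι => stdGaussian (EuclideanSpace ℝ κ))
      = 1 / (Fintype.card κ - S.card - 1) * (K.trace + V.trace / Fintype.card κ) := by
    intro j
    rw [integral_add (iK4 j) (iV2 j), integral_finsetSum _ fun k _ => iK3 j k,
      integral_finsetSum _ fun a _ => iV1 j a]
    simp_rw [integral_finsetSum _ fun l _ => iK2 j _ l, integral_finsetSum _ fun a _ => iK1 j _ _ a,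
      integral_finsetSum _ fun b _ => iK j _ _ _ b, integral_finsetSum _ fun b _ => iV j _ b,
      integral_mul_const, (hK j _ _ _ _).2, integral_dualFamily_restrict_mul h]
    have h0 : (Fintype.card κ : ℝ) ≠ 0 := by
      have : Fintype.card κ ≠ 0 := by omega
      exact_mod_cast this
    have h1 : (Fintype.card κ - S.card - 1 : ℝ) ≠ 0 := by
      have : (S.card + 2 : ℝ) ≤ Fintype.card κ := by exact_mod_cast h
      linarith
    -- Only a = b and k = l survive. In the `K` term the sum over a has n equal terms, cancelling
    -- the factor 1/n of the second moment; in the `V` term it forms the trace and 1/n remains.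
    simp only [ite_mul, zero_mul, Finset.sum_ite_irrel, Finset.sum_ite_eq, Finset.mem_univ,
      if_true, Finset.sum_const_zero, Finset.sum_const, Finset.card_univ, nsmul_eq_mul,
      ← Finset.mul_sum, Matrix.trace, Matrix.diag_apply]
    field_simp
  rw [Finset.sum_congr rfl fun j _ => hj j]
  rw [Finset.sum_const, Finset.card_univ, Fintype.card_coe, nsmul_eq_mul]
  ring

end Blocks

/-! ### The expected error and its monotonicity -/

namespace PartialLMMSE

namespace LinearSystem

variable {p n : ℕ} (M : LinearSystem.{u₁, u₂} p n) (S : Finset (Fin p))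

/-- The identity holds wherever the columns in `S` are linearly independent. It expresses the error
through the columns alone, whose law is known. -/
theorem ae_mseS_partialLMMSE_eq (hS : S.card + 2 ≤ n) :
    ∀ᵐ ω' ∂M.Q, M.mseS S (M.A ω') (partialLMMSE S (M.A ω')) =
      (fun c : Fin p → EuclideanSpace ℝ (Fin n) => ∑ j : S,
        (∑ k : (Sᶜ : Finset (Fin p)), ∑ l : (Sᶜ : Finset (Fin p)),
            (∑ a, dualFamily (fun k : S => c k) j a * c k a)
            * (∑ a, dualFamily (fun k : S => c k) j a * c l a) * M.covXSub Sᶜ k l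
          + ∑ a, ∑ b, dualFamily (fun k : S => c k) j a * dualFamily (fun k : S => c k) j b
            * M.covV a b)) (fun j => WithLp.toLp 2 fun i => M.A ω' i j) := by
  have hlaw := hasLaw_columns M.indep_rows M.law_rows
  have hLI : ∀ᵐ c ∂(Measure.pi fun _ : Fin p => stdGaussian (EuclideanSpace ℝ (Fin n))),
      LinearIndependent ℝ fun j : S => c j :=
    (measurePreserving_restrict_pi_stdGaussian S).quasiMeasurePreserving.ae
      (ae_linearIndependent_pi_stdGaussian (by simpa using hS))
  rw [← hlaw.map_eq] at hLI
  filter_upwards [ae_of_ae_map hlaw.aemeasurable hLI] with ω' hc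
  have hA : ∀ i j, (fun j => WithLp.toLp 2 fun i => M.A ω' i j :
      Fin p → EuclideanSpace ℝ (Fin n)) j i = M.A ω' i j := fun i j => rfl
  rw [M.mseS_eq_of_mul_eq S (partialLMMSE_mul_apply hA hc)]
  simp only [Matrix.mul_apply, partialLMMSE_apply hA hc]

theorem integrable_mseS_partialLMMSE (hS : S.card + 2 ≤ n) :
    Integrable (fun ω' => M.mseS S (M.A ω') (partialLMMSE S (M.A ω'))) M.Q := by
  have hlaw := hasLaw_columns M.indep_rows M.law_rows
  have h := (integrable_and_integral_dualFamily_quadratic (S := S) (by simpa using hS)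
    (M.covXSub Sᶜ) M.covV).1
  rw [← hlaw.map_eq] at h
  exact (h.comp_aemeasurable hlaw.aemeasurable).congr
    ((M.ae_mseS_partialLMMSE_eq S hS).mono fun _ h => h.symm)

theorem expectedMSES_eq (hS : S.card + 2 ≤ n) :
    M.expectedMSES S
      = S.card / (n - S.card - 1) * ((M.covXSub Sᶜ).trace + M.covV.trace / n) := by
  have hlaw := hasLaw_columns M.indep_rows M.law_rows
  have h := integrable_and_integral_dualFamily_quadratic (S := S) (by simpa using hS)
    (M.covXSub Sᶜ) M.covV
  rw [← hlaw.map_eq] at h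
  have h2 := h.2
  rw [integral_map hlaw.aemeasurable h.1.aestronglyMeasurable] at h2
  rw [expectedMSES, integral_congr_ae (M.ae_mseS_partialLMMSE_eq S hS), h2, Fintype.card_fin]

theorem expectedMSE_eq_mseCurve {σx σv : ℝ} (h : M.HasPowers S σx σv) (hn : p + 1 < n) :
    M.expectedMSE S = mseCurve p n σx σv S.card := by
  have hS : S.card ≤ p := by simpa using S.card_le_univ
  have hn0 : (n : ℝ) ≠ 0 := by
    have : n ≠ 0 := by omega
    exact_mod_cast this
  -- This resolves the minimum in the curve, so its first term is zero.
  have hle : (S.card : ℝ) ≤ n := by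
    have : S.card ≤ n := by omega
    exact_mod_cast this
  rw [expectedMSE, M.expectedMSES_eq S (by omega), h.trace_C, h.trace_v, Finset.card_compl,
    Fintype.card_fin, Nat.cast_sub hS, mseCurve, min_eq_left hle, mul_div_cancel_left₀ _ hn0]
  ring

end LinearSystem

/-- Substituting t / (n - t - 1) = (n - 1) / (n - t - 1) - 1 isolates the dependence on t in a
single reciprocal, which increases on t < n - 1. -/
theorem mseCurve_eq {p n : ℕ} {σx σv t : ℝ} (hσx : 0 < σx) (ht : t < n - 1) :
    mseCurve p n σx σv t
      = (n - 1) * σx ^ 2 * (p + σv ^ 2 / σx ^ 2 + 1 - n) * (n - t - 1)⁻¹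
        + (σx ^ 2 * (n - 1) - σv ^ 2) := by
  have h1 : (n - t - 1 : ℝ) ≠ 0 := by linarith
  have h2 : σx ≠ 0 := hσx.ne'
  rw [mseCurve, min_eq_left (by linarith)]
  field_simp
  ring

theorem mseCurve_lt_of_lt {p n : ℕ} {σx σv s t : ℝ} (hσx : 0 < σx) (hn : 1 < n)
    (h : p + σv ^ 2 / σx ^ 2 + 1 < n) (hst : s < t) (ht : t < n - 1) :
    mseCurve p n σx σv t < mseCurve p n σx σv s := by
  rw [mseCurve_eq hσx ht, mseCurve_eq hσx (hst.trans ht)]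
  have hn' : (1 : ℝ) < n := by exact_mod_cast hn
  have hinv : (n - s - 1 : ℝ)⁻¹ < (n - t - 1)⁻¹ :=
    inv_strictAnti₀ (by linarith) (by linarith)
  have hneg : (n - 1) * σx ^ 2 * (p + σv ^ 2 / σx ^ 2 + 1 - n) < 0 :=
    mul_neg_of_pos_of_neg (mul_pos (by linarith) (by positivity)) (by linarith)
  linarith [mul_lt_mul_of_neg_left hinv hneg]

theorem lt_mseCurve_of_lt {p n : ℕ} {σx σv s t : ℝ} (hσx : 0 < σx) (hn : 1 < n)
    (h : n < p + σv ^ 2 / σx ^ 2 + 1) (hst : s < t) (ht : t < n - 1) :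
    mseCurve p n σx σv s < mseCurve p n σx σv t := by
  rw [mseCurve_eq hσx ht, mseCurve_eq hσx (hst.trans ht)]
  have hn' : (1 : ℝ) < n := by exact_mod_cast hn
  have hinv : (n - s - 1 : ℝ)⁻¹ < (n - t - 1)⁻¹ :=
    inv_strictAnti₀ (by linarith) (by linarith)
  have hpos : 0 < (n - 1) * σx ^ 2 * (p + σv ^ 2 / σx ^ 2 + 1 - n) :=
    mul_pos (mul_pos (by linarith) (by positivity)) (by linarith)
  linarith [mul_lt_mul_of_pos_left hinv hpos]

end PartialLMMSE

theorem corollary2 (p n : ℕ) (hn : p + 1 < n) (σx σv : ℝ) (hσx : 0 < σx) (hσv : 0 < σv) :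
    -- the expected MSE is finite, depends on `S` through `p_S` alone, and is given by the curve
    (∀ (M : PartialLMMSE.LinearSystem.{u₁, u₂} p n) (S : Finset (Fin p)), M.HasPowers S σx σv →
      (∀ A W, MeasureTheory.Integrable (M.sqError S A W) M.P) ∧
      MeasureTheory.Integrable
        (fun ω' => M.mseS S (M.A ω') (PartialLMMSE.partialLMMSE S (M.A ω'))) M.Q ∧
      M.expectedMSE S = PartialLMMSE.mseCurve p n σx σv S.card) ∧
    -- many samples: decreasing in `p_S`, as a real variable and as the number of estimated unknowns
    ((p : ℝ) + σv ^ 2 / σx ^ 2 + 1 < n →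
      StrictAntiOn (PartialLMMSE.mseCurve p n σx σv) (Set.Ioc 0 (p : ℝ)) ∧
      ∀ (M M' : PartialLMMSE.LinearSystem.{u₁, u₂} p n) (S S' : Finset (Fin p)),
        M.HasPowers S σx σv → M'.HasPowers S' σx σv → S.card < S'.card →
          M'.expectedMSE S' < M.expectedMSE S) ∧
    -- few samples: increasing in `p_S`, in both senses
    ((n : ℝ) < p + σv ^ 2 / σx ^ 2 + 1 →
      StrictMonoOn (PartialLMMSE.mseCurve p n σx σv) (Set.Ioc 0 (p : ℝ)) ∧
      ∀ (M M' : PartialLMMSE.LinearSystem.{u₁, u₂} p n) (S S' : Finset (Fin p)),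
        M.HasPowers S σx σv → M'.HasPowers S' σx σv → S.card < S'.card →
          M.expectedMSE S < M'.expectedMSE S') := by
  have hn' : (p + 1 : ℝ) < n := by exact_mod_cast hn
  have hn1 : 1 < n := by omega
  have hcard : ∀ S : Finset (Fin p), (S.card : ℝ) < n - 1 := fun S => by
    have hS : S.card ≤ p := by simpa using S.card_le_univ
    have : (S.card : ℝ) ≤ p := by exact_mod_cast hS
    linarith
  refine ⟨fun M S h => ⟨M.integrable_sqError S, M.integrable_mseS_partialLMMSE S ?_,
    M.expectedMSE_eq_mseCurve S h hn⟩, fun hlt => ⟨?_, ?_⟩, fun hlt => ⟨?_, ?_⟩⟩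
  · have hS : S.card ≤ p := by simpa using S.card_le_univ
    omega
  · exact fun s _ t ht hst => PartialLMMSE.mseCurve_lt_of_lt hσx hn1 hlt hst (by linarith [ht.2])
  · intro M M' S S' h h' hSS'
    rw [M.expectedMSE_eq_mseCurve S h hn, M'.expectedMSE_eq_mseCurve S' h' hn]
    exact PartialLMMSE.mseCurve_lt_of_lt hσx hn1 hlt (by exact_mod_cast hSS') (hcard S')
  · exact fun s _ t ht hst => PartialLMMSE.lt_mseCurve_of_lt hσx hn1 hlt hst (by linarith [ht.2])
  · intro M M' S S' h h' hSS'
    rw [M.expectedMSE_eq_mseCurve S h hn, M'.expectedMSE_eq_mseCurve S' h' hn]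
    exact PartialLMMSE.lt_mseCurve_of_lt hσx hn1 hlt (by exact_mod_cast hSS') (hcard S')
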